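/- Let $X$ be a compact metric space with metric $d$, $f:X\to X$ continuous and $\varphi:X\to\mathbb R$ continuous. Let $\mathcal M(X)$ be the space of Borel probability measures on $X$ with the weak-* topology, let $h_\mu(f)\in[0,+\infty]$ be the Kolmogorov–Sinai entropy of an invariant measure $\mu$, and put $S_n\varphi(x)=\sum_{i=0}^{n-1}\varphi(f^ix)$. Let $\epsilon,\delta>0$ and $n\ge 1$. A set $E\subset X$ is $(n,\epsilon)$-separated if $\max_{0\le i<n}d(f^ix,f^iy)>\epsilon$ for all distinct $x,y\in E$, and $(\delta,n,\epsilon)$-separated if $\#\{0\le j\le n-1: d(f^jx,f^jy)>\epsilon\}\ge\delta n$ for all distinct $x,y\in E$. For $F\subset\mathcal M(X)$ let $X_{n,F}=\{x\in X:\frac1n\sum_{k=0}^{n-1}\delta_{f^kx}\in F\}$; let $N(F;\delta,n,\epsilon)$ be the maximal cardinality of a $(\delta,n,\epsilon)$-separated subset of $X_{n,F}$, and let $P(F;\varphi,n,\epsilon)$, respectively $P(F;\varphi,\delta,n,\epsilon)$, be the supremum of $\sum_{x\in E}e^{S_n\varphi(x)}$ over the $(n,\epsilon)$-separated, respectively $(\delta,n,\epsilon)$-separated,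 sets $E\subset X_{n,F}$. For $\mu\in\mathcal M(X)$ define, with $F$ ranging over the neighbourhoods of $\mu$ in $\mathcal M(X)$ and $\log 0=-\infty$, $$\overline{SP}_\mu(f,\varphi)=\lim_{\epsilon\to0}\inf_{F\ni\mu}\limsup_{n\to\infty}\tfrac1n\log P(F;\varphi,n,\epsilon),\qquad \overline{SP}'_\mu(f,\varphi)=\lim_{\epsilon\to0}\lim_{\delta\to0}\inf_{F\ni\mu}\limsup_{n\to\infty}\tfrac1n\log P(F;\varphi,\delta,n,\epsilon),$$ and define $\underline{SP}_\mu(f,\varphi)$, $\underline{SP}'_\mu(f,\varphi)$ in the same way with $\liminf_{n\to\infty}$ in place of $\limsup_{n\to\infty}$. If $\overline{SP}_\mu=\underline{SP}_\mu$, the common value is denoted $SP_\mu(f,\varphi)$; if $\overline{SP}'_\mu=\underline{SP}'_\mu$, the common value is denoted $SP'_\mu(f,\varphi)$. Assume that (1) (uniform separation property) for every $\eta>0$ there are $\delta^*>0$ and $\epsilon^*>0$ such that for every ergodic invariant $\mu\in\mathcal M(X)$ and every neighbourhood $F\subset\mathcal M(X)$ of $\mu$ there is $n^*\in\mathbb N$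 with $N(F;\delta^*,n,\epsilon^*)\ge e^{n(h_\mu(f)-\eta)}$ for all $n\ge n^*$; (2) (the ergodic measures are entropy dense) for every invariant $\nu\in\mathcal M(X)$, every neighbourhood $F\subset\mathcal M(X)$ of $\nu$ and every real $h^*<h_\nu(f)$ there is an ergodic invariant $\mu\in F$ with $h_\mu(f)>h^*$. Then for every $f$-invariant $\mu\in\mathcal M(X)$, ergodic or not, $SP_\mu(f,\varphi)$ and $SP'_\mu(f,\varphi)$ exist and $$SP_\mu(f,\varphi)=SP'_\mu(f,\varphi)=h_\mu(f)+\int_X\varphi\,d\mu.$$ -/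

import Mathlib

open MeasureTheory Filter Topology
open scoped ENNReal NNReal

noncomputable section

namespace TDS

/-! ### Kolmogorov–Sinai entropy -/

section Entropy

variable {X : Type*} [MeasurableSpace X]

/-- A finite measurable partition into `k` labelled (possibly empty) pieces is given by its
labelling map `ξ : X → Fin k`. The atoms of the join `ξ ∨ f⁻¹ξ ∨ ⋯ ∨ f^{-(n-1)}ξ` are the sets of
points having a given itinerary `w` of length `n`. -/
def joinAtom {k : ℕ} (f : X → X) (ξ : X → Fin k) (n : ℕ) (w : Fin n → Fin k) : Set X :=
  {x | ∀ i : Fin n, ξ (f^[i] x) = w i}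

/-- The Shannon entropy `H_μ(ξ ∨ f⁻¹ξ ∨ ⋯ ∨ f^{-(n-1)}ξ)`, with `0 log 0 = 0`. -/
def joinEntropy {k : ℕ} (μ : Measure X) (f : X → X) (ξ : X → Fin k) (n : ℕ) : ℝ :=
  ∑ w : Fin n → Fin k, Real.negMulLog (μ.real (joinAtom f ξ n w))

/-- The entropy `h_μ(f, ξ) = lim (1/n) H_μ(ξ ∨ ⋯ ∨ f^{-(n-1)}ξ)` of `f` relative to a finite
partition. For an invariant probability measure the sequence converges (subadditivity), so
the `limsup` is the limit. -/
def partitionEntropy {k : ℕ} (μ : Measure X) (f : X → X) (ξ : X → Fin k) : EReal :=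
  limsup (fun n : ℕ => ((joinEntropy μ f ξ n / n : ℝ) : EReal)) atTop

/-- The Kolmogorov–Sinai entropy `h_μ(f) ∈ [0, +∞]`: the supremum of `h_μ(f, ξ)` over all finite
measurable partitions `ξ`. -/
def ksEntropy (μ : Measure X) (f : X → X) : EReal :=
  ⨆ (k : ℕ) (ξ : X → Fin k) (_ : Measurable ξ), partitionEntropy μ f ξ

end Entropy

/-! ### Separated sets -/

section Separated

variable {X : Type*} [MetricSpace X]

/-- The dynamical metric `d_n(x, y) = max {d(fⁱx, fⁱy) : 0 ≤ i < n}`. -/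
def dynDist (f : X → X) (n : ℕ) (x y : X) : ℝ≥0 :=
  (Finset.range n).sup fun i => nndist (f^[i] x) (f^[i] y)

/-- `E` is `(n, ε)`-separated. -/
def IsSep (f : X → X) (n : ℕ) (ε : ℝ) (E : Set X) : Prop :=
  ∀ x ∈ E, ∀ y ∈ E, x ≠ y → ε < dynDist f n x y

open Classical in
/-- `A` is `(δ, n, ε)`-separated. -/
def IsSepDelta (f : X → X) (δ : ℝ) (n : ℕ) (ε : ℝ) (A : Set X) : Prop :=
  ∀ x ∈ A, ∀ y ∈ A, x ≠ y →
    δ * n ≤ ((Finset.range n).filter fun j => ε < dist (f^[j] x) (f^[j] y)).card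

theorem IsSepDelta.mono {f : X → X} {δ δ' : ℝ} {n : ℕ} {ε ε' : ℝ} {A : Set X}
    (h : IsSepDelta f δ' n ε' A) (hδ : δ ≤ δ') (hε : ε ≤ ε') : IsSepDelta f δ n ε A := by
  classical
  intro x hx y hy hxy
  refine (mul_le_mul_of_nonneg_right hδ n.cast_nonneg).trans ((h x hx y hy hxy).trans ?_)
  refine Nat.cast_le.mpr (Finset.card_le_card fun j hj => ?_)
  simp only [Finset.mem_filter] at hj ⊢
  exact ⟨hj.1, hε.trans_lt hj.2⟩

end Separated

/-! ### Empirical measures and pressures -/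

section Pressure

variable {X : Type*} [MeasurableSpace X]

/-- The empirical measure `(1/n) ∑_{k < n} δ_{fᵏ x}` (a probability measure as soon as `n ≥ 1`). -/
def empirical (f : X → X) (n : ℕ) (x : X) : Measure X :=
  (n : ℝ≥0∞)⁻¹ • ∑ k ∈ Finset.range n, Measure.dirac (f^[k] x)

/-- The set `X_{n,F}` of points whose empirical measure of order `n` belongs to `F`. -/
def empiricalSet (f : X → X) (n : ℕ) (F : Set (ProbabilityMeasure X)) : Set X :=
  {x | ∃ m ∈ F, (m : Measure X) = empirical f n x}

variable [MetricSpace X]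

/-- `N(F; δ, n, ε)`, the largest cardinality of a `(δ, n, ε)`-separated subset of `X_{n,F}`.
(In a compact space, such sets are finite for `δ, ε > 0`.) -/
def sepCard (f : X → X) (F : Set (ProbabilityMeasure X)) (δ : ℝ) (n : ℕ) (ε : ℝ) : ℝ≥0∞ :=
  ⨆ (A : Finset X) (_ : (A : Set X) ⊆ empiricalSet f n F) (_ : IsSepDelta f δ n ε A),
    (A.card : ℝ≥0∞)

/-- `P(F; φ, n, ε)`, the supremum of `∑_{x ∈ E} exp (S_n φ (x))` over the `(n, ε)`-separated
subsets `E` of `X_{n,F}`. (In a compact space, such sets are finite for `ε > 0`.) -/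
def sepSum (f : X → X) (φ : X → ℝ) (F : Set (ProbabilityMeasure X)) (n : ℕ) (ε : ℝ) : ℝ≥0∞ :=
  ⨆ (E : Finset X) (_ : (E : Set X) ⊆ empiricalSet f n F) (_ : IsSep f n ε E),
    ∑ x ∈ E, ENNReal.ofReal (Real.exp (birkhoffSum f φ n x))

/-- `P(F; φ, δ, n, ε)`, the same supremum over the `(δ, n, ε)`-separated subsets of `X_{n,F}`. -/
def sepSumDelta (f : X → X) (φ : X → ℝ) (F : Set (ProbabilityMeasure X)) (δ : ℝ) (n : ℕ)
    (ε : ℝ) : ℝ≥0∞ :=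
  ⨆ (A : Finset X) (_ : (A : Set X) ⊆ empiricalSet f n F) (_ : IsSepDelta f δ n ε A),
    ∑ x ∈ A, ENNReal.ofReal (Real.exp (birkhoffSum f φ n x))

variable [BorelSpace X]

/-- `inf_{F ∋ ν} limsup_n (1/n) log P(F; φ, n, ε)`, `F` ranging over the weak-* neighbourhoods
of `ν`. -/
def upperSPAt (f : X → X) (φ : X → ℝ) (ν : ProbabilityMeasure X) (ε : ℝ) : EReal :=
  ⨅ F ∈ 𝓝 ν, ExpGrowth.expGrowthSup fun n => sepSum f φ F n ε

/-- `inf_{F ∋ ν} liminf_n (1/n) log P(F; φ, n, ε)`. -/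
def lowerSPAt (f : X → X) (φ : X → ℝ) (ν : ProbabilityMeasure X) (ε : ℝ) : EReal :=
  ⨅ F ∈ 𝓝 ν, ExpGrowth.expGrowthInf fun n => sepSum f φ F n ε

/-- `inf_{F ∋ ν} limsup_n (1/n) log P(F; φ, δ, n, ε)`. -/
def upperSPDeltaAt (f : X → X) (φ : X → ℝ) (ν : ProbabilityMeasure X) (ε δ : ℝ) : EReal :=
  ⨅ F ∈ 𝓝 ν, ExpGrowth.expGrowthSup fun n => sepSumDelta f φ F δ n ε

/-- `inf_{F ∋ ν} liminf_n (1/n) log P(F; φ, δ, n, ε)`. -/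
def lowerSPDeltaAt (f : X → X) (φ : X → ℝ) (ν : ProbabilityMeasure X) (ε δ : ℝ) : EReal :=
  ⨅ F ∈ 𝓝 ν, ExpGrowth.expGrowthInf fun n => sepSumDelta f φ F δ n ε

/-- The upper pressure defined by `(n, ε)`-separated sets: the limit as `ε → 0⁺`. This limit and
the ones below exist by monotonicity; see `tendsto_upperSPAt` and its companions. -/
def upperSP (f : X → X) (φ : X → ℝ) (ν : ProbabilityMeasure X) : EReal :=
  limUnder (𝓝[>] (0 : ℝ)) fun ε => upperSPAt f φ ν ε

/-- The lower pressure defined by `(n, ε)`-separated sets. -/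
def lowerSP (f : X → X) (φ : X → ℝ) (ν : ProbabilityMeasure X) : EReal :=
  limUnder (𝓝[>] (0 : ℝ)) fun ε => lowerSPAt f φ ν ε

/-- The upper pressure defined by `(δ, n, ε)`-separated sets: `lim_{ε → 0⁺} lim_{δ → 0⁺}`. -/
def upperSP' (f : X → X) (φ : X → ℝ) (ν : ProbabilityMeasure X) : EReal :=
  limUnder (𝓝[>] (0 : ℝ)) fun ε => limUnder (𝓝[>] (0 : ℝ)) fun δ => upperSPDeltaAt f φ ν ε δ

/-- The lower pressure defined by `(δ, n, ε)`-separated sets: `lim_{ε → 0⁺} lim_{δ → 0⁺}`. -/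
def lowerSP' (f : X → X) (φ : X → ℝ) (ν : ProbabilityMeasure X) : EReal :=
  limUnder (𝓝[>] (0 : ℝ)) fun ε => limUnder (𝓝[>] (0 : ℝ)) fun δ => lowerSPDeltaAt f φ ν ε δ

/-! ### The two hypotheses -/

/-- The ergodic measures are entropy dense. -/
def ErgodicEntropyDense (f : X → X) : Prop :=
  ∀ ν : ProbabilityMeasure X, MeasurePreserving f (ν : Measure X) ν →
    ∀ F ∈ 𝓝 ν, ∀ a : ℝ, (a : EReal) < ksEntropy (ν : Measure X) f →
      ∃ m ∈ F, Ergodic f (m : Measure X) ∧ (a : EReal) < ksEntropy (m : Measure X) f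

/-- The uniform separation property: for every `η > 0` there are `δ*, ε* > 0` such that, for each
ergodic `m` and each neighbourhood `F` of `m`, `N(F; δ*, n, ε*) ≥ exp (n (h_m(f) - η))` for all
large `n`. -/
def UniformSeparation (f : X → X) : Prop :=
  ∀ η : ℝ, 0 < η → ∃ δ : ℝ, 0 < δ ∧ ∃ ε : ℝ, 0 < ε ∧
    ∀ m : ProbabilityMeasure X, Ergodic f (m : Measure X) → ∀ F ∈ 𝓝 m,
      ∃ N : ℕ, ∀ n ≥ N,
        EReal.exp ((n : EReal) * (ksEntropy (m : Measure X) f - (η : EReal))) ≤ sepCard f F δ n ε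

end Pressure

/-! ### Existence of the limits -/

section Limits

variable {X : Type*} [MeasurableSpace X] [MetricSpace X]

theorem sepSum_antitone (f : X → X) (φ : X → ℝ) (F : Set (ProbabilityMeasure X)) (n : ℕ) :
    Antitone fun ε => sepSum f φ F n ε := fun _ _ hε =>
  iSup_mono fun _ => iSup_mono fun _ => iSup_le fun h =>
    le_iSup_of_le (fun x hx y hy hxy => hε.trans_lt (h x hx y hy hxy)) le_rfl

theorem sepSumDelta_mono (f : X → X) (φ : X → ℝ) (F : Set (ProbabilityMeasure X)) (n : ℕ)
    {δ δ' ε ε' : ℝ} (hδ : δ ≤ δ') (hε : ε ≤ ε') :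
    sepSumDelta f φ F δ' n ε' ≤ sepSumDelta f φ F δ n ε :=
  iSup_mono fun _ => iSup_mono fun _ => iSup_le fun h => le_iSup_of_le (h.mono hδ hε) le_rfl

/-- A monotone limit at `0⁺`. -/
theorem tendsto_limUnder_of_antitone {g : ℝ → EReal} (hg : Antitone g) :
    Tendsto g (𝓝[>] (0 : ℝ)) (𝓝 (limUnder (𝓝[>] (0 : ℝ)) g)) ∧
      limUnder (𝓝[>] (0 : ℝ)) g = ⨆ t ∈ Set.Ioi (0 : ℝ), g t := by
  have h := hg.tendsto_nhdsGT 0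
  rw [sSup_image] at h
  exact ⟨h.limUnder_eq.symm ▸ h, h.limUnder_eq⟩

variable [BorelSpace X]

theorem upperSPAt_antitone (f : X → X) (φ : X → ℝ) (ν : ProbabilityMeasure X) :
    Antitone fun ε => upperSPAt f φ ν ε := fun _ _ hε =>
  iInf₂_mono fun F _ => ExpGrowth.expGrowthSup_monotone fun n => sepSum_antitone f φ F n hε

theorem tendsto_upperSPAt (f : X → X) (φ : X → ℝ) (ν : ProbabilityMeasure X) :
    Tendsto (fun ε => upperSPAt f φ ν ε) (𝓝[>] 0) (𝓝 (upperSP f φ ν)) :=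
  (tendsto_limUnder_of_antitone (upperSPAt_antitone f φ ν)).1

theorem lowerSPAt_antitone (f : X → X) (φ : X → ℝ) (ν : ProbabilityMeasure X) :
    Antitone fun ε => lowerSPAt f φ ν ε := fun _ _ hε =>
  iInf₂_mono fun F _ => ExpGrowth.expGrowthInf_monotone fun n => sepSum_antitone f φ F n hε

theorem tendsto_lowerSPAt (f : X → X) (φ : X → ℝ) (ν : ProbabilityMeasure X) :
    Tendsto (fun ε => lowerSPAt f φ ν ε) (𝓝[>] 0) (𝓝 (lowerSP f φ ν)) :=
  (tendsto_limUnder_of_antitone (lowerSPAt_antitone f φ ν)).1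

theorem upperSPDeltaAt_mono (f : X → X) (φ : X → ℝ) (ν : ProbabilityMeasure X)
    {δ δ' ε ε' : ℝ} (hδ : δ ≤ δ') (hε : ε ≤ ε') :
    upperSPDeltaAt f φ ν ε' δ' ≤ upperSPDeltaAt f φ ν ε δ :=
  iInf₂_mono fun F _ => ExpGrowth.expGrowthSup_monotone fun n => sepSumDelta_mono f φ F n hδ hε

theorem tendsto_upperSPDeltaAt (f : X → X) (φ : X → ℝ) (ν : ProbabilityMeasure X) :
    (∀ ε, Tendsto (fun δ => upperSPDeltaAt f φ ν ε δ) (𝓝[>] 0)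
      (𝓝 (limUnder (𝓝[>] (0 : ℝ)) fun δ => upperSPDeltaAt f φ ν ε δ))) ∧
    Tendsto (fun ε => limUnder (𝓝[>] (0 : ℝ)) fun δ => upperSPDeltaAt f φ ν ε δ) (𝓝[>] 0)
      (𝓝 (upperSP' f φ ν)) := by
  have h : ∀ ε, Antitone fun δ => upperSPDeltaAt f φ ν ε δ := fun ε _ _ hδ =>
    upperSPDeltaAt_mono f φ ν hδ le_rfl
  refine ⟨fun ε => (tendsto_limUnder_of_antitone (h ε)).1,
    (tendsto_limUnder_of_antitone fun ε ε' hε => ?_).1⟩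
  simp only [(tendsto_limUnder_of_antitone (h _)).2]
  exact iSup₂_mono fun δ _ => upperSPDeltaAt_mono f φ ν le_rfl hε

theorem lowerSPDeltaAt_mono (f : X → X) (φ : X → ℝ) (ν : ProbabilityMeasure X)
    {δ δ' ε ε' : ℝ} (hδ : δ ≤ δ') (hε : ε ≤ ε') :
    lowerSPDeltaAt f φ ν ε' δ' ≤ lowerSPDeltaAt f φ ν ε δ :=
  iInf₂_mono fun F _ => ExpGrowth.expGrowthInf_monotone fun n => sepSumDelta_mono f φ F n hδ hε

theorem tendsto_lowerSPDeltaAt (f : X → X) (φ : X → ℝ) (ν : ProbabilityMeasure X) :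
    (∀ ε, Tendsto (fun δ => lowerSPDeltaAt f φ ν ε δ) (𝓝[>] 0)
      (𝓝 (limUnder (𝓝[>] (0 : ℝ)) fun δ => lowerSPDeltaAt f φ ν ε δ))) ∧
    Tendsto (fun ε => limUnder (𝓝[>] (0 : ℝ)) fun δ => lowerSPDeltaAt f φ ν ε δ) (𝓝[>] 0)
      (𝓝 (lowerSP' f φ ν)) := by
  have h : ∀ ε, Antitone fun δ => lowerSPDeltaAt f φ ν ε δ := fun ε _ _ hδ =>
    lowerSPDeltaAt_mono f φ ν hδ le_rfl
  refine ⟨fun ε => (tendsto_limUnder_of_antitone (h ε)).1,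
    (tendsto_limUnder_of_antitone fun ε ε' hε => ?_).1⟩
  simp only [(tendsto_limUnder_of_antitone (h _)).2]
  exact iSup₂_mono fun δ _ => lowerSPDeltaAt_mono f φ ν le_rfl hε

end Limits

end TDS

end

namespace TDS

/-! Passing from `(n, ε)`- to `(δ, n, ε)`-separation, or from limsup to liminf, can only decrease
the pressure. All four quantities therefore lie between `lowerSP'` and `upperSP`, and two
inequalities suffice.

Upper bound (`upperSP_le`), valid for every invariant measure by coding alone. Take a partition with
atoms of diameter at most `ε` and `μ`-null boundaries, and a code for its words of length `k` whose
mean length under `μ` is close to the entropy `H_k` of the `k`-fold join. Mean code length is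
continuous at `μ`, so orbits with empirical measure near `μ` cost about `H_k` per block. Separated
points have different names, hence a Kraft inequality allows about `exp (n H_k / k)` of them
(`card_le_of_code_length_le`), each of weight about `exp (n ∫ φ dμ)`. Finally `k → ∞`.

Lower bound (`le_lowerSP'`). Uniform separation fixes `δ, ε` before the neighbourhood `F` of `μ` is
given. Entropy density puts in `F` an ergodic measure of almost the entropy of `μ`, whose many
separated orbits are counted in `X_{n,F}` and have weight about `exp (n ∫ φ dμ)`. -/

/-! ### Codes for words and counting of names -/

/-- The word of length `k` read off by `ξ` along the orbit of `x`. -/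
def itinerary {X : Type*} {K : ℕ} (f : X → X) (ξ : X → Fin K) (k : ℕ) (x : X) : Fin k → Fin K :=
  fun i => ξ (f^[i] x)

theorem itinerary_preimage {X : Type*} {K : ℕ} (f : X → X) (ξ : X → Fin K) (k : ℕ)
    (w : Fin k → Fin K) : itinerary f ξ k ⁻¹' {w} = joinAtom f ξ k w := by
  ext x
  simp [itinerary, joinAtom, funext_iff]

/-- Writing `i = r * k + j` sorts the positions by residue mod `k`; each class starts consecutive
disjoint blocks of length `k`. -/
theorem sum_range_mul_offset (g : ℕ → ℝ) (k M : ℕ) :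
    ∑ i ∈ Finset.range (M * k), g i = ∑ j : Fin k, ∑ r : Fin M, g (r * k + j) := by
  rw [Finset.sum_comm, Finset.sum_range, ← Fintype.sum_prod_type',
    ← (finProdFinEquiv (m := M) (n := k)).sum_comp]
  refine Finset.sum_congr rfl fun p _ => ?_
  congr 1
  simp [finProdFinEquiv]
  ring

/-- A Kraft-type bound: if the orbit segments of length `n` of the points of `E` have mean code
length at most `c` with respect to a code for words of length `k`, and have different names, then
`E` has at most `exp (n c / k)` elements, up to a factor independent of `n`. -/
theorem card_le_of_code_length_le {X : Type*} {K k : ℕ} (f : X → X) (ξ : X → Fin K) (hk : 0 < k)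
    (G : (Fin k → Fin K) → ℝ) (hG0 : ∀ w, 0 ≤ G w) (hG : ∑ w, Real.exp (-G w) ≤ 1)
    (n : ℕ) (c : ℝ) (E : Finset X)
    (hE : ∀ x ∈ E, ∑ i ∈ Finset.range n, G (itinerary f ξ k (f^[i] x)) ≤ n * c)
    (hinj : ∀ x ∈ E, ∀ y ∈ E, (∀ i < n, ξ (f^[i] x) = ξ (f^[i] y)) → x = y) :
    (E.card : ℝ) ≤ k * Fintype.card (Fin k → Fin K) ^ 2 * Real.exp (n * c / k) := by
  set M := n / k with hM
  have hMn : M * k ≤ n := Nat.div_mul_le_self n k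
  have hnM : n < M * k + k := by
    have := Nat.lt_div_mul_add (a := n) hk
    omega
  have hk' : (0 : ℝ) < k := Nat.cast_pos.mpr hk
  -- The `k` residue classes share a total cost of at most `n * c`, so the cheapest costs at most
  -- the average.
  have hoff : ∀ x ∈ E, ∃ j : Fin k,
      ∑ r : Fin M, G (itinerary f ξ k (f^[r * k + j] x)) ≤ n * c / k := by
    intro x hx
    by_contra! hcon
    have : NeZero k := ⟨hk.ne'⟩
    have h1 : ∑ _j : Fin k, n * c / k <
        ∑ j : Fin k, ∑ r : Fin M, G (itinerary f ξ k (f^[r * k + j] x)) :=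
      Finset.sum_lt_sum_of_nonempty Finset.univ_nonempty fun j _ => hcon j
    rw [← sum_range_mul_offset (fun i => G (itinerary f ξ k (f^[i] x)))] at h1
    have h2 : ∑ i ∈ Finset.range (M * k), G (itinerary f ξ k (f^[i] x)) ≤ n * c :=
      (Finset.sum_le_sum_of_subset_of_nonneg (Finset.range_mono hMn) fun _ _ _ => hG0 _).trans
        (hE x hx)
    rw [Finset.sum_const, Finset.card_univ, Fintype.card_fin, nsmul_eq_mul,
      mul_div_cancel₀ _ hk'.ne'] at h1
    linarith
  have : NeZero k := ⟨hk.ne'⟩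
  choose! j hj using hoff
  -- The `M` blocks with offset `j x` cover the times from `j x` to beyond `M * k`. The two extra
  -- words cover the times before `j x` and the incomplete block after `M * k`, so the code
  -- determines the name up to time `n`.
  let code : X → Fin k × (Fin M → Fin k → Fin K) × (Fin k → Fin K) × (Fin k → Fin K) := fun x =>
    (j x, fun r => itinerary f ξ k (f^[r * k + j x] x), itinerary f ξ k x,
      itinerary f ξ k (f^[M * k] x))
  have hcode : Set.InjOn code E := by
    intro x hx y hy hxy
    simp only [code, Prod.mk.injEq] at hxy
    obtain ⟨h1, h2, h3, h4⟩ := hxy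
    rw [← h1] at h2
    refine hinj x hx y hy fun i hi => ?_
    have split (a : ℕ) (ha : a ≤ i) (hak : i - a < k)
        (h : itinerary f ξ k (f^[a] x) = itinerary f ξ k (f^[a] y)) :
        ξ (f^[i] x) = ξ (f^[i] y) := by
      have := congrFun h ⟨i - a, hak⟩
      simpa only [itinerary, ← Function.iterate_add_apply, Nat.sub_add_cancel ha] using this
    rcases lt_or_ge i (j x) with h | h
    · exact split 0 (Nat.zero_le _) (by have := (j x).2; omega) h3
    rcases lt_or_ge i (M * k) with h' | h'
    · have hr : (i - j x) / k < M := (Nat.div_lt_iff_lt_mul hk).2 (by omega)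
      have e := Nat.div_add_mod' (i - j x) k
      have e' := Nat.mod_lt (i - j x) hk
      exact split ((i - j x) / k * k + j x) (by omega) (by omega) (congrFun h2 ⟨_, hr⟩)
    · exact split (M * k) h' (by omega) h4
  -- Code lengths add under concatenation, so Kraft's inequality passes to sequences of `M` blocks.
  have hpow : ∑ v : Fin M → Fin k → Fin K, ∏ r, Real.exp (-G (v r)) ≤ 1 := by
    rw [← Fintype.prod_sum fun (_ : Fin M) w => Real.exp (-G w)]
    exact Finset.prod_le_one (fun _ _ => Finset.sum_nonneg fun _ _ => (Real.exp_pos _).le)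
      fun _ _ => hG
  have hterm : ∀ x ∈ E,
      1 ≤ Real.exp (n * c / k) * ∏ r, Real.exp (-G ((code x).2.1 r)) := by
    intro x hx
    rw [← Real.exp_sum, ← Real.exp_add, Real.one_le_exp_iff, Finset.sum_neg_distrib]
    have := hj x hx
    simp only [code]
    linarith
  calc (E.card : ℝ) = ∑ x ∈ E, 1 := by simp
    _ ≤ ∑ x ∈ E, Real.exp (n * c / k) * ∏ r, Real.exp (-G ((code x).2.1 r)) :=
      Finset.sum_le_sum hterm
    _ = Real.exp (n * c / k) * ∑ p ∈ E.image code, ∏ r, Real.exp (-G (p.2.1 r)) := by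
      rw [Finset.sum_image hcode, Finset.mul_sum]
    _ ≤ Real.exp (n * c / k) * ∑ p : Fin k × (Fin M → Fin k → Fin K) × (Fin k → Fin K) ×
        (Fin k → Fin K), ∏ r, Real.exp (-G (p.2.1 r)) := by
      gcongr
      exact Finset.subset_univ _
    _ = Real.exp (n * c / k) * (k * Fintype.card (Fin k → Fin K) ^ 2 *
        ∑ v : Fin M → Fin k → Fin K, ∏ r, Real.exp (-G (v r))) := by
      simp only [Fintype.sum_prod_type, Finset.sum_const, Finset.card_univ, nsmul_eq_mul,
        Fintype.card_fin, ← Finset.mul_sum, Fintype.card_prod, Nat.cast_mul]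
      ring
    _ ≤ Real.exp (n * c / k) * (k * Fintype.card (Fin k → Fin K) ^ 2 * 1) := by gcongr
    _ = _ := by ring

/-- Every probability vector `p` has a code with mean length close to the entropy of `p`. -/
theorem exists_code_length {W : Type*} [Fintype W] (p : W → ℝ) (hp : ∀ w, 0 ≤ p w)
    (hp1 : ∑ w, p w = 1) {η : ℝ} (hη : 0 < η) :
    ∃ G : W → ℝ, (∀ w, 0 ≤ G w) ∧ ∑ w, Real.exp (-G w) ≤ 1 ∧
      ∑ w, p w * G w ≤ ∑ w, Real.negMulLog (p w) + η := by
  have : Nonempty W := by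
    by_contra h
    rw [not_nonempty_iff] at h
    simp at hp1
  have hW : (0 : ℝ) < Fintype.card W := Nat.cast_pos.mpr Fintype.card_pos
  have he : Real.exp (-η) < 1 := Real.exp_lt_one_iff.2 (by linarith)
  have he0 := Real.exp_pos (-η)
  -- A little uniform mass makes `q` positive, so that `-log q` is a genuine length even where `p`
  -- vanishes. Since `q ≥ exp (-η) * p`, this costs at most `η`.
  let q : W → ℝ := fun w => Real.exp (-η) * p w + (1 - Real.exp (-η)) / Fintype.card W
  have hq : ∀ w, 0 < q w := fun w =>
    add_pos_of_nonneg_of_pos (mul_nonneg he0.le (hp w)) (div_pos (by linarith) hW)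
  have hq1 : ∑ w, q w = 1 := by
    simp only [q, Finset.sum_add_distrib, ← Finset.mul_sum, hp1, Finset.sum_const,
      Finset.card_univ, nsmul_eq_mul]
    field_simp
    ring
  refine ⟨fun w => -Real.log (q w), fun w => ?_, ?_, ?_⟩
  · have : q w ≤ 1 := hq1 ▸ Finset.single_le_sum (fun w _ => (hq w).le) (Finset.mem_univ w)
    simpa using Real.log_nonpos (hq w).le this
  · simp only [neg_neg, Real.exp_log (hq _), hq1, le_refl]
  · calc ∑ w, p w * -Real.log (q w) ≤ ∑ w, (Real.negMulLog (p w) + p w * η) := by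
          refine Finset.sum_le_sum fun w _ => ?_
          rcases (hp w).eq_or_lt with h | h
          · simp [← h]
          have : Real.log (Real.exp (-η) * p w) ≤ Real.log (q w) :=
            Real.log_le_log (by positivity)
              (le_add_of_nonneg_right (div_nonneg (by linarith) hW.le))
          rw [Real.log_mul he0.ne' h.ne', Real.log_exp] at this
          rw [Real.negMulLog]
          nlinarith
      _ = _ := by rw [Finset.sum_add_distrib, ← Finset.sum_mul, hp1, one_mul]

/-! ### Fine partitions with null boundaries -/

theorem measure_frontier_iInter_eq_zero {X ι : Type*} [TopologicalSpace X] [MeasurableSpace X]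
    [Finite ι] {μ : Measure X} {s : ι → Set X} (h : ∀ i, μ (frontier (s i)) = 0) :
    μ (frontier (⋂ i, s i)) = 0 := by
  refine measure_mono_null ?_ (measure_iUnion_null h)
  intro x hx
  rw [frontier, interior_iInter_of_finite] at hx
  obtain ⟨h1, h2⟩ := hx
  rw [Set.mem_iInter, not_forall] at h2
  obtain ⟨i, hi⟩ := h2
  exact Set.mem_iUnion.2 ⟨i, closure_mono (Set.iInter_subset s i) h1, hi⟩

/-- Cover `X` by finitely many balls of radius below `ε / 2` with null boundary, and label a point
by the set of balls containing it. Points with equal labels share a ball. -/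
theorem exists_partition_null_frontier {X : Type*} [MetricSpace X] [CompactSpace X]
    [MeasurableSpace X] [BorelSpace X] (μ : Measure X) [IsFiniteMeasure μ] {ε : ℝ} (hε : 0 < ε) :
    ∃ (K : ℕ) (ξ : X → Fin K), Measurable ξ ∧ (∀ x y, ξ x = ξ y → dist x y ≤ ε) ∧
      ∀ i, μ (frontier (ξ ⁻¹' {i})) = 0 := by
  classical
  have hr : ∀ x : X, ∃ r ∈ Set.Ioo (0 : ℝ) (ε / 2), μ (frontier (Metric.ball x r)) = 0 := by
    intro x
    simpa using exists_null_frontier_thickening μ {x} (half_pos hε)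
  choose r hr hr0 using hr
  obtain ⟨t, ht⟩ := CompactSpace.elim_nhds_subcover (fun x => Metric.ball x (r x))
    fun x => Metric.ball_mem_nhds x (hr x).1
  let B : t → Set X := fun c => Metric.ball (c : X) (r c)
  let ξ : X → t → Prop := fun x c => x ∈ B c
  have hpre : ∀ v : t → Prop, ξ ⁻¹' {v} = ⋂ c, if v c then B c else (B c)ᶜ := by
    intro v
    ext x
    simp only [Set.mem_preimage, Set.mem_singleton_iff, funext_iff, Set.mem_iInter, ξ]
    refine forall_congr' fun c => ?_
    split_ifs with h <;> simp [h]
  have hmeas : Measurable ξ := measurable_pi_iff.2 fun c => 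
    measurable_mem.2 Metric.isOpen_ball.measurableSet
  refine ⟨Fintype.card (t → Prop), fun x => Fintype.equivFin _ (ξ x), ?_, ?_, ?_⟩
  · exact (measurable_of_finite (Fintype.equivFin (t → Prop))).comp hmeas
  · intro x y hxy
    have hξ : ξ x = ξ y := (Fintype.equivFin _).injective hxy
    have hx : x ∈ ⋃ c ∈ t, Metric.ball c (r c) := ht ▸ Set.mem_univ x
    simp only [Set.mem_iUnion] at hx
    obtain ⟨c, hc, hxc⟩ := hx
    have hyc : y ∈ Metric.ball c (r c) := (congrFun hξ ⟨c, hc⟩).mp hxc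
    have h1 := Metric.mem_ball.1 hxc
    have h2 := Metric.mem_ball'.1 hyc
    have h3 := (hr c).2
    have := dist_triangle x c y
    linarith
  · intro i
    have : (fun x => Fintype.equivFin (t → Prop) (ξ x)) ⁻¹' {i} =
        ξ ⁻¹' {(Fintype.equivFin (t → Prop)).symm i} := by
      ext x
      simp [Equiv.eq_symm_apply]
    rw [this, hpre]
    refine measure_frontier_iInter_eq_zero fun c => ?_
    split_ifs
    · exact hr0 c
    · rw [frontier_compl]
      exact hr0 c

/-! ### Words and empirical measures -/

section

variable {X : Type*} [MeasurableSpace X]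

theorem integral_empirical [MeasurableSingletonClass X] (f : X → X) (n : ℕ) (x : X) (g : X → ℝ) :
    ∫ y, g y ∂(empirical f n x) = (n : ℝ)⁻¹ * ∑ i ∈ Finset.range n, g (f^[i] x) := by
  rw [empirical, integral_smul_measure,
    integral_finsetSum_measure fun i _ => integrable_dirac (by simp)]
  simp [integral_dirac]

theorem measurable_itinerary {f : X → X} (hf : Measurable f) {K : ℕ} {ξ : X → Fin K}
    (hξ : Measurable ξ) (k : ℕ) : Measurable (itinerary f ξ k) :=
  measurable_pi_iff.2 fun i => hξ.comp (hf.iterate i)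

/-- Reduces the mean code length to finitely many measures of atoms, the form in which its
continuity at `μ` is checked. -/
theorem integral_comp_itinerary {f : X → X} (hf : Measurable f) {K : ℕ} {ξ : X → Fin K}
    (hξ : Measurable ξ) {k : ℕ} (m : Measure X) [IsFiniteMeasure m] (G : (Fin k → Fin K) → ℝ) :
    ∫ x, G (itinerary f ξ k x) ∂m = ∑ w, m.real (joinAtom f ξ k w) * G w := by
  have hm := measurable_itinerary hf hξ k
  rw [← integral_map (f := G) hm.aemeasurable (measurable_of_finite G).aestronglyMeasurable,
    integral_fintype (by simp)]
  refine Finset.sum_congr rfl fun w _ => ?_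
  rw [map_measureReal_apply hm (measurableSet_singleton w), itinerary_preimage, smul_eq_mul]

theorem sum_measureReal_joinAtom {f : X → X} (hf : Measurable f) {K : ℕ} {ξ : X → Fin K}
    (hξ : Measurable ξ) {k : ℕ} (m : Measure X) [IsProbabilityMeasure m] :
    ∑ w, m.real (joinAtom f ξ k w) = 1 := by
  simpa using (integral_comp_itinerary hf hξ (k := k) m fun _ => 1).symm

theorem measure_frontier_joinAtom_eq_zero [TopologicalSpace X] [OpensMeasurableSpace X]
    {f : X → X} (hf : Continuous f) {K : ℕ} {ξ : X → Fin K} {μ : Measure X}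
    (hμ : MeasurePreserving f μ μ) (h : ∀ i, μ (frontier (ξ ⁻¹' {i})) = 0) (k : ℕ)
    (w : Fin k → Fin K) : μ (frontier (joinAtom f ξ k w)) = 0 := by
  have : joinAtom f ξ k w = ⋂ i : Fin k, f^[i] ⁻¹' (ξ ⁻¹' {w i}) := by
    ext x
    simp [joinAtom]
  rw [this]
  refine measure_frontier_iInter_eq_zero fun i => ?_
  refine measure_mono_null ((hf.iterate i).frontier_preimage_subset _) ?_
  rw [(hμ.iterate i).measure_preimage isClosed_frontier.measurableSet.nullMeasurableSet, h]

end

/-! ### Separated sets and comparison of the pressures -/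

section

variable {X : Type*} [MetricSpace X]

theorem IsSepDelta.isSep {f : X → X} {δ : ℝ} {n : ℕ} {ε : ℝ} {A : Set X}
    (h : IsSepDelta f δ n ε A) (hδ : 0 < δ) (hn : 0 < n) : IsSep f n ε A := by
  classical
  intro x hx y hy hxy
  have h1 := h x hx y hy hxy
  have h2 : (0 : ℝ) < δ * n := mul_pos hδ (Nat.cast_pos.2 hn)
  obtain ⟨j, hj⟩ := Finset.card_pos.1 (Nat.cast_pos.1 (h2.trans_le h1))
  rw [Finset.mem_filter] at hj
  have h3 := Finset.le_sup (f := fun i => nndist (f^[i] x) (f^[i] y)) hj.1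
  refine hj.2.trans_le ?_
  rw [dist_nndist]
  exact_mod_cast h3

theorem IsSep.eq_of_forall_dist_le {f : X → X} {n : ℕ} {ε : ℝ} (hε : 0 ≤ ε) {E : Set X}
    (h : IsSep f n ε E) {x y : X} (hx : x ∈ E) (hy : y ∈ E)
    (hxy : ∀ i < n, dist (f^[i] x) (f^[i] y) ≤ ε) : x = y := by
  by_contra hne
  refine (h x hx y hy hne).not_ge ?_
  have : dynDist f n x y ≤ ε.toNNReal := Finset.sup_le fun i hi => by
    rw [Real.le_toNNReal_iff_coe_le hε, coe_nndist]
    exact hxy i (Finset.mem_range.1 hi)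
  exact (Real.le_toNNReal_iff_coe_le hε).1 this

end

section

variable {X : Type*} [MeasurableSpace X]

theorem empiricalSet_mono (f : X → X) (n : ℕ) {F F' : Set (ProbabilityMeasure X)} (h : F ⊆ F') :
    empiricalSet f n F ⊆ empiricalSet f n F' := fun _ ⟨m, hm, e⟩ => ⟨m, h hm, e⟩

variable [MetricSpace X]

theorem sepSumDelta_le_sepSum (f : X → X) (φ : X → ℝ) (F : Set (ProbabilityMeasure X)) {δ : ℝ}
    (hδ : 0 < δ) {n : ℕ} (hn : 0 < n) (ε : ℝ) : sepSumDelta f φ F δ n ε ≤ sepSum f φ F n ε :=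
  iSup_mono fun _ => iSup_mono fun _ => iSup_le fun h => le_iSup_of_le (h.isSep hδ hn) le_rfl

variable [BorelSpace X]

/-- No regularity of `φ` is needed, so this serves both for the potential and for the discontinuous
code length. -/
theorem birkhoffSum_eq_of_empirical {f : X → X} (φ : X → ℝ) {n : ℕ} (hn : 0 < n) {x : X}
    {m : ProbabilityMeasure X} (h : (m : Measure X) = empirical f n x) :
    birkhoffSum f φ n x = n * ∫ y, φ y ∂(m : Measure X) := by
  have hn' : (n : ℝ) ≠ 0 := Nat.cast_ne_zero.2 hn.ne'
  rw [h, integral_empirical, mul_inv_cancel_left₀ hn', birkhoffSum]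

theorem upperSPDeltaAt_le_upperSPAt (f : X → X) (φ : X → ℝ) (μ : ProbabilityMeasure X) {δ : ℝ}
    (hδ : 0 < δ) (ε : ℝ) : upperSPDeltaAt f φ μ ε δ ≤ upperSPAt f φ μ ε :=
  iInf₂_mono fun F _ => ExpGrowth.expGrowthSup_eventually_monotone <|
    (eventually_gt_atTop 0).mono fun _ hn => sepSumDelta_le_sepSum f φ F hδ hn ε

theorem lowerSPDeltaAt_le_lowerSPAt (f : X → X) (φ : X → ℝ) (μ : ProbabilityMeasure X) {δ : ℝ}
    (hδ : 0 < δ) (ε : ℝ) : lowerSPDeltaAt f φ μ ε δ ≤ lowerSPAt f φ μ ε :=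
  iInf₂_mono fun F _ => ExpGrowth.expGrowthInf_eventually_monotone <|
    (eventually_gt_atTop 0).mono fun _ hn => sepSumDelta_le_sepSum f φ F hδ hn ε

/-- Monotone limits are suprema: an upper bound must be proved at every scale, a lower bound at a
single one. -/
theorem upperSP_eq_iSup (f : X → X) (φ : X → ℝ) (μ : ProbabilityMeasure X) :
    upperSP f φ μ = ⨆ ε ∈ Set.Ioi (0 : ℝ), upperSPAt f φ μ ε :=
  (tendsto_limUnder_of_antitone (upperSPAt_antitone f φ μ)).2

theorem lowerSP_eq_iSup (f : X → X) (φ : X → ℝ) (μ : ProbabilityMeasure X) :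
    lowerSP f φ μ = ⨆ ε ∈ Set.Ioi (0 : ℝ), lowerSPAt f φ μ ε :=
  (tendsto_limUnder_of_antitone (lowerSPAt_antitone f φ μ)).2

theorem upperSP'_eq_iSup (f : X → X) (φ : X → ℝ) (μ : ProbabilityMeasure X) :
    upperSP' f φ μ = ⨆ ε ∈ Set.Ioi (0 : ℝ), ⨆ δ ∈ Set.Ioi (0 : ℝ), upperSPDeltaAt f φ μ ε δ := by
  have h : ∀ ε, limUnder (𝓝[>] (0 : ℝ)) (fun δ => upperSPDeltaAt f φ μ ε δ) =
      ⨆ δ ∈ Set.Ioi (0 : ℝ), upperSPDeltaAt f φ μ ε δ := fun ε =>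
    (tendsto_limUnder_of_antitone fun _ _ hδ => upperSPDeltaAt_mono f φ μ hδ le_rfl).2
  simp only [upperSP', h]
  exact (tendsto_limUnder_of_antitone fun _ _ hε =>
    iSup₂_mono fun _ _ => upperSPDeltaAt_mono f φ μ le_rfl hε).2

theorem lowerSP'_eq_iSup (f : X → X) (φ : X → ℝ) (μ : ProbabilityMeasure X) :
    lowerSP' f φ μ = ⨆ ε ∈ Set.Ioi (0 : ℝ), ⨆ δ ∈ Set.Ioi (0 : ℝ), lowerSPDeltaAt f φ μ ε δ := by
  have h : ∀ ε, limUnder (𝓝[>] (0 : ℝ)) (fun δ => lowerSPDeltaAt f φ μ ε δ) =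
      ⨆ δ ∈ Set.Ioi (0 : ℝ), lowerSPDeltaAt f φ μ ε δ := fun ε =>
    (tendsto_limUnder_of_antitone fun _ _ hδ => lowerSPDeltaAt_mono f φ μ hδ le_rfl).2
  simp only [lowerSP', h]
  exact (tendsto_limUnder_of_antitone fun _ _ hε =>
    iSup₂_mono fun _ _ => lowerSPDeltaAt_mono f φ μ le_rfl hε).2

theorem upperSP'_le_upperSP (f : X → X) (φ : X → ℝ) (μ : ProbabilityMeasure X) :
    upperSP' f φ μ ≤ upperSP f φ μ := by
  rw [upperSP'_eq_iSup, upperSP_eq_iSup]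
  exact iSup₂_mono fun ε _ => iSup₂_le fun δ hδ => upperSPDeltaAt_le_upperSPAt f φ μ hδ ε

theorem lowerSP'_le_lowerSP (f : X → X) (φ : X → ℝ) (μ : ProbabilityMeasure X) :
    lowerSP' f φ μ ≤ lowerSP f φ μ := by
  rw [lowerSP'_eq_iSup, lowerSP_eq_iSup]
  exact iSup₂_mono fun ε _ => iSup₂_le fun δ hδ => lowerSPDeltaAt_le_lowerSPAt f φ μ hδ ε

theorem lowerSP_le_upperSP (f : X → X) (φ : X → ℝ) (μ : ProbabilityMeasure X) :
    lowerSP f φ μ ≤ upperSP f φ μ := by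
  rw [lowerSP_eq_iSup, upperSP_eq_iSup]
  exact iSup₂_mono fun _ _ => iInf₂_mono fun _ _ => ExpGrowth.expGrowthInf_le_expGrowthSup

theorem lowerSP'_le_upperSP' (f : X → X) (φ : X → ℝ) (μ : ProbabilityMeasure X) :
    lowerSP' f φ μ ≤ upperSP' f φ μ := by
  rw [lowerSP'_eq_iSup, upperSP'_eq_iSup]
  exact iSup₂_mono fun _ _ => iSup₂_mono fun _ _ => iInf₂_mono fun _ _ =>
    ExpGrowth.expGrowthInf_le_expGrowthSup

/-- Portmanteau: continuity of `f` and invariance of `μ` carry null boundaries from `ξ` to the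
joins. -/
theorem tendsto_measureReal_joinAtom {f : X → X} (hf : Continuous f) {μ : ProbabilityMeasure X}
    (hμ : MeasurePreserving f (μ : Measure X) μ) {K : ℕ} {ξ : X → Fin K}
    (h : ∀ i, (μ : Measure X) (frontier (ξ ⁻¹' {i})) = 0) (k : ℕ) (w : Fin k → Fin K) :
    Tendsto (fun m : ProbabilityMeasure X => (m : Measure X).real (joinAtom f ξ k w)) (𝓝 μ)
      (𝓝 ((μ : Measure X).real (joinAtom f ξ k w))) :=
  (ENNReal.tendsto_toReal (measure_ne_top _ _)).comp
    (ProbabilityMeasure.tendsto_measure_of_null_frontier_of_tendsto' tendsto_id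
      (measure_frontier_joinAtom_eq_zero hf hμ h k w))

theorem sepCard_mul_exp_le_sepSumDelta {f : X → X} {φ : X → ℝ} {F F' : Set (ProbabilityMeasure X)}
    (hF : F' ⊆ F) {b : ℝ} (hb : ∀ m ∈ F', b ≤ ∫ x, φ x ∂(m : Measure X)) (δ : ℝ) {n : ℕ}
    (hn : 0 < n) (ε : ℝ) :
    sepCard f F' δ n ε * ENNReal.ofReal (Real.exp (n * b)) ≤ sepSumDelta f φ F δ n ε := by
  simp only [sepCard, ENNReal.iSup_mul]
  refine iSup_mono fun A => iSup_le fun hA =>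
    le_iSup_of_le (hA.trans (empiricalSet_mono f n hF)) (iSup_mono fun _ => ?_)
  have h : ∀ x ∈ A, ENNReal.ofReal (Real.exp (n * b)) ≤
      ENNReal.ofReal (Real.exp (birkhoffSum f φ n x)) := by
    intro x hx
    obtain ⟨m, hm, hmx⟩ := hA hx
    rw [birkhoffSum_eq_of_empirical φ hn hmx]
    exact ENNReal.ofReal_le_ofReal
      (Real.exp_le_exp.2 (mul_le_mul_of_nonneg_left (hb m hm) n.cast_nonneg))
  simpa using Finset.card_nsmul_le_sum A _ _ h

variable [CompactSpace X]

theorem continuous_integral_probabilityMeasure {φ : X → ℝ} (hφ : Continuous φ) :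
    Continuous fun m : ProbabilityMeasure X => ∫ x, φ x ∂(m : Measure X) :=
  ProbabilityMeasure.continuous_integral_continuousMap (⟨φ, hφ⟩ : C(X, ℝ))

/-! ### The upper bound -/

theorem upperSPAt_le_joinEntropy_div {f : X → X} (hf : Continuous f) {φ : X → ℝ}
    (hφ : Continuous φ) {μ : ProbabilityMeasure X}
    (hμ : MeasurePreserving f (μ : Measure X) μ) {ε : ℝ} (hε : 0 < ε) {K : ℕ} {ξ : X → Fin K}
    (hξ : Measurable ξ) (hdiam : ∀ x y, ξ x = ξ y → dist x y ≤ ε)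
    (hnull : ∀ i, (μ : Measure X) (frontier (ξ ⁻¹' {i})) = 0) {k : ℕ} (hk : 0 < k) :
    upperSPAt f φ μ ε ≤
      ((joinEntropy (μ : Measure X) f ξ k / k + ∫ x, φ x ∂(μ : Measure X) : ℝ) : EReal) := by
  set H := joinEntropy (μ : Measure X) f ξ k with hH
  set I := ∫ x, φ x ∂(μ : Measure X) with hI
  refine EReal.le_of_forall_lt_iff_le.1 fun z hz => ?_
  rw [EReal.coe_lt_coe_iff] at hz
  -- One `η` pays for the code, one for the variation of the mean code length over `F`, one for that
  -- of `∫ φ`.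
  obtain ⟨η, hη, hηz⟩ : ∃ η > 0, H / k + I + 3 * η = z :=
    ⟨(z - (H / k + I)) / 3, by linarith, by ring⟩
  obtain ⟨G, hG0, hG1, hGH⟩ := exists_code_length
    (fun w => (μ : Measure X).real (joinAtom f ξ k w)) (fun _ => measureReal_nonneg)
    (sum_measureReal_joinAtom hf.measurable hξ _) hη
  let F : Set (ProbabilityMeasure X) :=
    {m | ∑ w, (m : Measure X).real (joinAtom f ξ k w) * G w < H + 2 * η} ∩
      {m | ∫ x, φ x ∂(m : Measure X) < I + η}
  have hF : F ∈ 𝓝 μ := by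
    refine inter_mem ?_ ?_
    · have ht : Tendsto (fun m : ProbabilityMeasure X =>
          ∑ w, (m : Measure X).real (joinAtom f ξ k w) * G w) (𝓝 μ) _ :=
        tendsto_finsetSum _ fun w _ =>
          (tendsto_measureReal_joinAtom hf hμ hnull k w).mul_const (G w)
      refine ht.eventually_lt_const (hGH.trans_lt ?_)
      rw [hH, joinEntropy]
      linarith
    · exact (continuous_integral_probabilityMeasure hφ).continuousAt.eventually_lt_const
        (by linarith)
  refine (iInf₂_le F hF).trans ?_
  set C : ℝ := k * Fintype.card (Fin k → Fin K) ^ 2 with hC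
  have hC0 : 0 ≤ C := by positivity
  have hk' : (1 : ℝ) ≤ k := Nat.one_le_cast.2 hk
  -- The factor `C` does not depend on `n` and disappears from the growth rate.
  refine (ExpGrowth.expGrowthSup_le_of_eventually_le (b := ENNReal.ofReal C)
    (v := fun n : ℕ => EReal.exp ((z : EReal) * n)) ENNReal.ofReal_ne_top ?_).trans_eq
    ExpGrowth.expGrowthSup_exp
  filter_upwards [eventually_gt_atTop 0] with n hn
  refine iSup_le fun E => iSup₂_le fun hEF hE => ?_
  have hn' : (0 : ℝ) < n := Nat.cast_pos.2 hn
  have hcard : (E.card : ℝ) ≤ C * Real.exp (n * (H + 2 * η) / k) := by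
    refine card_le_of_code_length_le f ξ hk G hG0 hG1 n (H + 2 * η) E (fun x hx => ?_)
      fun x hx y hy hxy => hE.eq_of_forall_dist_le hε.le hx hy fun i hi => hdiam _ _ (hxy i hi)
    obtain ⟨m, hm, hmx⟩ := hEF hx
    have h1 := birkhoffSum_eq_of_empirical (fun y => G (itinerary f ξ k y)) hn hmx
    rw [integral_comp_itinerary hf.measurable hξ] at h1
    rw [birkhoffSum] at h1
    rw [h1]
    exact mul_le_mul_of_nonneg_left (le_of_lt hm.1) hn'.le
  have hsum : ∀ x ∈ E, ENNReal.ofReal (Real.exp (birkhoffSum f φ n x)) ≤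
      ENNReal.ofReal (Real.exp (n * (I + η))) := by
    intro x hx
    obtain ⟨m, hm, hmx⟩ := hEF hx
    rw [birkhoffSum_eq_of_empirical φ hn hmx]
    exact ENNReal.ofReal_le_ofReal
      (Real.exp_le_exp.2 (mul_le_mul_of_nonneg_left (le_of_lt hm.2) hn'.le))
  calc ∑ x ∈ E, ENNReal.ofReal (Real.exp (birkhoffSum f φ n x))
      ≤ E.card * ENNReal.ofReal (Real.exp (n * (I + η))) := by
        simpa using Finset.sum_le_card_nsmul E _ _ hsum
    _ ≤ ENNReal.ofReal (C * Real.exp (n * (H + 2 * η) / k)) *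
        ENNReal.ofReal (Real.exp (n * (I + η))) := by
        gcongr
        rw [← ENNReal.ofReal_natCast]
        exact ENNReal.ofReal_le_ofReal hcard
    _ = ENNReal.ofReal C * ENNReal.ofReal (Real.exp (n * (H + 2 * η) / k + n * (I + η))) := by
        rw [ENNReal.ofReal_mul hC0, mul_assoc, ← ENNReal.ofReal_mul (Real.exp_pos _).le,
          Real.exp_add]
    _ ≤ ENNReal.ofReal C * EReal.exp ((z : EReal) * n) := by
        rw [show ((z : EReal) * n) = ((z * n : ℝ) : EReal) by push_cast; rfl, EReal.exp_coe]
        gcongr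
        have h2 : 2 * η / k ≤ 2 * η := div_le_self (by positivity) hk'
        calc n * (H + 2 * η) / k + n * (I + η) = n * (H / k + 2 * η / k + (I + η)) := by ring
          _ ≤ n * (H / k + 2 * η + (I + η)) := by gcongr
          _ = z * n := by rw [← hηz]; ring

theorem upperSP_le {f : X → X} (hf : Continuous f) {φ : X → ℝ}
    (hφ : Continuous φ) {μ : ProbabilityMeasure X}
    (hμ : MeasurePreserving f (μ : Measure X) μ) :
    upperSP f φ μ ≤ ksEntropy (μ : Measure X) f + ((∫ x, φ x ∂(μ : Measure X) : ℝ) : EReal) := by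
  rw [upperSP_eq_iSup]
  refine iSup₂_le fun ε hε => ?_
  obtain ⟨K, ξ, hξ, hdiam, hnull⟩ := exists_partition_null_frontier (μ : Measure X) hε
  set I := ∫ x, φ x ∂(μ : Measure X)
  rw [← EReal.sub_le_iff_le_add (.inl (EReal.coe_ne_bot I)) (.inl (EReal.coe_ne_top I))]
  refine le_trans ?_ (le_iSup_of_le K (le_iSup₂_of_le ξ hξ le_rfl))
  -- The bound holds for each `k ≥ 1`, so the limsup suffices and convergence of `H_k / k` is not
  -- needed.
  refine le_limsup_of_frequently_le (Eventually.frequently ?_)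
  filter_upwards [eventually_gt_atTop 0] with k hk
  rw [EReal.sub_le_iff_le_add (.inl (EReal.coe_ne_bot I)) (.inl (EReal.coe_ne_top I)),
    ← EReal.coe_add]
  exact upperSPAt_le_joinEntropy_div hf hφ hμ hε hξ hdiam hnull hk

/-! ### The lower bound -/

theorem exists_le_lowerSPDeltaAt {f : X → X} (hsep : UniformSeparation f)
    (hdense : ErgodicEntropyDense f) {φ : X → ℝ} (hφ : Continuous φ) {μ : ProbabilityMeasure X}
    (hμ : MeasurePreserving f (μ : Measure X) μ) {a : ℝ}
    (ha : (a : EReal) < ksEntropy (μ : Measure X) f) {η : ℝ} (hη : 0 < η) :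
    ∃ ε > 0, ∃ δ > 0,
      (((a - η) + (∫ x, φ x ∂(μ : Measure X) - η) : ℝ) : EReal) ≤ lowerSPDeltaAt f φ μ ε δ := by
  obtain ⟨δ, hδ, ε, hε, h⟩ := hsep η hη
  -- The scales depend on `η` only; the ergodic measure below may vary with `F`.
  refine ⟨ε, hε, δ, hδ, le_iInf₂ fun F hF => ?_⟩
  set b := ∫ x, φ x ∂(μ : Measure X) - η with hb
  -- `F'` must be open: it has to be a neighbourhood of the approximating measure `m` as well as of
  -- `μ`.
  let F' : Set (ProbabilityMeasure X) := interior F ∩ {m | b < ∫ x, φ x ∂(m : Measure X)}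
  have hF'o : IsOpen F' := isOpen_interior.inter
    (isOpen_lt continuous_const (continuous_integral_probabilityMeasure hφ))
  obtain ⟨m, hmF, hm, ham⟩ := hdense μ hμ F'
    (hF'o.mem_nhds ⟨mem_interior_iff_mem_nhds.2 hF, by simp [hb, hη]⟩) a ha
  obtain ⟨N, hN⟩ := h m hm F' (hF'o.mem_nhds hmF)
  refine Eventually.le_expGrowthInf ?_
  filter_upwards [eventually_ge_atTop N, eventually_gt_atTop 0] with n hnN hn
  calc EReal.exp (((a - η + b : ℝ) : EReal) * n)
      = EReal.exp ((n : EReal) * ((a : EReal) - (η : EReal))) *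
          ENNReal.ofReal (Real.exp (n * b)) := by
        rw [← EReal.exp_coe, ← EReal.exp_add]
        congr 1
        norm_cast
        ring
    _ ≤ sepCard f F' δ n ε * ENNReal.ofReal (Real.exp (n * b)) := by
        gcongr
        refine (EReal.exp_monotone ?_).trans (hN n hnN)
        exact mul_le_mul_of_nonneg_left (EReal.sub_le_sub ham.le le_rfl) n.cast_nonneg'
    _ ≤ _ := sepCard_mul_exp_le_sepSumDelta (Set.inter_subset_left.trans interior_subset)
        (fun m hm => le_of_lt hm.2) δ hn ε

theorem le_lowerSP' {f : X → X} (hsep : UniformSeparation f)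
    (hdense : ErgodicEntropyDense f) {φ : X → ℝ} (hφ : Continuous φ) {μ : ProbabilityMeasure X}
    (hμ : MeasurePreserving f (μ : Measure X) μ) :
    ksEntropy (μ : Measure X) f + ((∫ x, φ x ∂(μ : Measure X) : ℝ) : EReal) ≤
      lowerSP' f φ μ := by
  set I := ∫ x, φ x ∂(μ : Measure X) with hI
  rw [← EReal.le_sub_iff_add_le (.inl (EReal.coe_ne_bot I)) (.inl (EReal.coe_ne_top I))]
  -- Approximation by reals `a` from below also covers infinite entropy.
  refine EReal.ge_of_forall_gt_iff_ge.1 fun a ha => ?_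
  rw [EReal.le_sub_iff_add_le (.inl (EReal.coe_ne_bot I)) (.inl (EReal.coe_ne_top I)),
    ← EReal.coe_add]
  refine EReal.ge_of_forall_gt_iff_ge.1 fun z hz => ?_
  rw [EReal.coe_lt_coe_iff] at hz
  obtain ⟨ε, hε, δ, hδ, h⟩ := exists_le_lowerSPDeltaAt hsep hdense hφ hμ ha
    (η := (a + I - z) / 2) (by linarith)
  rw [← hI, show a - (a + I - z) / 2 + (I - (a + I - z) / 2) = z by ring] at h
  rw [lowerSP'_eq_iSup]
  exact h.trans (le_iSup₂_of_le ε hε (le_iSup₂_of_le δ hδ le_rfl))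

end

end TDS

theorem theorem4p7 {X : Type*} [MetricSpace X] [CompactSpace X] [MeasurableSpace X] [BorelSpace X]
    (f : X → X) (hf : Continuous f)
    (hsep : TDS.UniformSeparation f) (hdense : TDS.ErgodicEntropyDense f)
    (φ : X → ℝ) (hφ : Continuous φ)
    (μ : ProbabilityMeasure X) (hμ : MeasurePreserving f (μ : Measure X) (μ : Measure X)) :
    (TDS.lowerSP f φ μ = TDS.ksEntropy (μ : Measure X) f + ((∫ x, φ x ∂(μ : Measure X) : ℝ) : EReal) ∧
      TDS.upperSP f φ μ = TDS.ksEntropy (μ : Measure X) f + ((∫ x, φ x ∂(μ : Measure X) : ℝ) : EReal)) ∧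
    (TDS.lowerSP' f φ μ = TDS.ksEntropy (μ : Measure X) f + ((∫ x, φ x ∂(μ : Measure X) : ℝ) : EReal) ∧
      TDS.upperSP' f φ μ = TDS.ksEntropy (μ : Measure X) f + ((∫ x, φ x ∂(μ : Measure X) : ℝ) : EReal)) := by
  have hu := TDS.upperSP_le hf hφ hμ
  have hl := TDS.le_lowerSP' hsep hdense hφ hμ
  have h1 := TDS.lowerSP'_le_lowerSP f φ μ
  have h2 := TDS.lowerSP_le_upperSP f φ μ
  have h3 := TDS.lowerSP'_le_upperSP' f φ μ
  have h4 := TDS.upperSP'_le_upperSP f φ μ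
  exact ⟨⟨le_antisymm (h2.trans hu) (hl.trans h1), le_antisymm hu (hl.trans (h1.trans h2))⟩,
    ⟨le_antisymm (h3.trans (h4.trans hu)) hl, le_antisymm (h4.trans hu) (hl.trans h3)⟩⟩
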